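/- Let $(M,h)$ and $(N,g)$ be complex manifolds (Hausdorff, of finite dimension, without boundary) with smooth Hermitian metrics, let $M$ be compact and connected, and let $f\colon M\to N$ be a holomorphic map. The curvature of a Hermitian metric $h$ is that of its Chern connection: in local holomorphic coordinates $(z^\alpha)$, with $h_{\alpha\bar\beta}=h(\partial/\partial z^\alpha,\partial/\partial z^\beta)$ and $h^{\alpha\bar\beta}h_{\gamma\bar\beta}=\delta^\alpha_\gamma$, $$R_{\mu\bar\nu\gamma\bar\delta}=-\frac{\partial^2 h_{\gamma\bar\delta}}{\partial z^\mu\,\partial\bar z^\nu}+h^{\alpha\bar\beta}\,\frac{\partial h_{\gamma\bar\beta}}{\partial z^\mu}\,\frac{\partial h_{\alpha\bar\delta}}{\partial\bar z^\nu},$$ and its holomorphic sectional curvature in the direction of a nonzero holomorphic tangent vector $W=W^\alpha\,\partial/\partial z^\alpha$ is the real number $R_{\mu\bar\nu\gamma\bar\delta}W^\mu\overline{W^\nu}W^\gamma\overline{W^\delta}/|W|_h^4$; it is called positive (non-negative, negative, non-positive) if it is so at every point and in every nonzero direction. Suppose that either 1. $(M,h)$ has positive and $(N,g)$ has non-positive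 holomorphic sectional curvature, or 2. $(M,h)$ has non-negative and $(N,g)$ has negative holomorphic sectional curvature. Then $f$ is constant. -/

import Mathlib

open scoped Manifold ContDiff ComplexConjugate

noncomputable section

namespace HermitianGeometry

/-- The model space `ℂ^m` of an `m`-dimensional complex manifold. -/
abbrev Cn (m : ℕ) : Type := EuclideanSpace ℂ (Fin m)

/-- The Wirtinger derivative `∂F/∂z^α = (1/2) (∂F/∂x^α - i ∂F/∂y^α)` of a function on `ℂ^m`,
where `z^α = x^α + i y^α`. -/
def dz {m : ℕ} (α : Fin m) (F : Cn m → ℂ) (z : Cn m) : ℂ :=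
  (1 / 2 : ℂ) * (fderiv ℝ F z (EuclideanSpace.single α (1 : ℂ))
    - Complex.I * fderiv ℝ F z (EuclideanSpace.single α Complex.I))

/-- The Wirtinger derivative `∂F/∂z̄^α = (1/2) (∂F/∂x^α + i ∂F/∂y^α)` of a function on `ℂ^m`. -/
def dzbar {m : ℕ} (α : Fin m) (F : Cn m → ℂ) (z : Cn m) : ℂ :=
  (1 / 2 : ℂ) * (fderiv ℝ F z (EuclideanSpace.single α (1 : ℂ))
    + Complex.I * fderiv ℝ F z (EuclideanSpace.single α Complex.I))

/-- The coordinate vector `∂/∂z^α` of the holomorphic chart `e`, at the point `e⁻¹(z)`. -/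
def coordVec {m : ℕ} {M : Type*} [TopologicalSpace M] [ChartedSpace (Cn m) M]
    (e : OpenPartialHomeomorph M (Cn m)) (z : Cn m) (α : Fin m) :
    TangentSpace 𝓘(ℂ, Cn m) (e.symm z) :=
  mfderiv 𝓘(ℂ, Cn m) 𝓘(ℂ, Cn m) e.symm z (EuclideanSpace.single α (1 : ℂ) : Cn m)

/-- A (smooth) Hermitian metric on a complex manifold `M` of dimension `m`: a positive definite
Hermitian form on every (holomorphic) tangent space, linear in the first and conjugate linear in
the second argument, whose components `h_{αβ̄} = h(∂/∂z^α, ∂/∂z^β)` in the holomorphic charts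
are smooth functions in the real sense. -/
structure HermitianMetric (m : ℕ) (M : Type*) [TopologicalSpace M] [ChartedSpace (Cn m) M] where
  /-- The Hermitian form on the tangent space at `x`. -/
  form : ∀ x : M, TangentSpace 𝓘(ℂ, Cn m) x →ₗ[ℂ] TangentSpace 𝓘(ℂ, Cn m) x →ₗ⋆[ℂ] ℂ
  conj_symm : ∀ (x : M) (v w : TangentSpace 𝓘(ℂ, Cn m) x), conj (form x v w) = form x w v
  pos_def : ∀ (x : M) (v : TangentSpace 𝓘(ℂ, Cn m) x), v ≠ 0 → 0 < (form x v v).re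
  smooth : ∀ e ∈ atlas (Cn m) M, ∀ α β : Fin m,
    ContDiffOn ℝ ∞ (fun z : Cn m => form (e.symm z) (coordVec e z α) (coordVec e z β)) e.target

namespace HermitianMetric

variable {m : ℕ} {M : Type*} [TopologicalSpace M] [ChartedSpace (Cn m) M]

/-- The matrix `(h_{αβ̄})` of the metric in the chart `e`, as a function of the coordinates. -/
def matrix (h : HermitianMetric m M) (e : OpenPartialHomeomorph M (Cn m)) (z : Cn m) :
    Matrix (Fin m) (Fin m) ℂ :=
  Matrix.of fun α β => h.form (e.symm z) (coordVec e z α) (coordVec e z β)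

/-- The components of the Chern curvature tensor in the chart `e`,
`R_{μν̄γδ̄} = - ∂²h_{γδ̄}/∂z^μ∂z̄^ν + h^{αβ̄} (∂h_{γβ̄}/∂z^μ) (∂h_{αδ̄}/∂z̄^ν)`.
Here `h^{αβ̄}` is determined by `h^{αβ̄} h_{γβ̄} = δ^α_γ`, so it is the `(β, α)` entry of the
inverse of the matrix `(h_{αβ̄})`. -/
def chernCurvature (h : HermitianMetric m M) (e : OpenPartialHomeomorph M (Cn m)) (z : Cn m)
    (μ ν γ δ : Fin m) : ℂ :=
  - dz μ (dzbar ν fun w => h.matrix e w γ δ) z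
    + ∑ α, ∑ β, (h.matrix e z)⁻¹ β α
        * dz μ (fun w => h.matrix e w γ β) z * dzbar ν (fun w => h.matrix e w α δ) z

/-- The holomorphic sectional curvature of the metric at `x` in the direction of a nonzero tangent
vector `v = W^μ ∂/∂z^μ`, which is `R_{μν̄γδ̄} W^μ W̄^ν W^γ W̄^δ / |v|^4`. The chart used is the
preferred one at `x`; as `R` is a tensor, the value does not depend on it. The numerator is a real
number, since `R_{μν̄γδ̄}` is the complex conjugate of `R_{νμ̄δγ̄}`. -/
def holSectCurv (h : HermitianMetric m M) (x : M) (v : TangentSpace 𝓘(ℂ, Cn m) x) : ℝ :=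
  let e : OpenPartialHomeomorph M (Cn m) := chartAt (Cn m) x
  let W : Cn m := mfderiv 𝓘(ℂ, Cn m) 𝓘(ℂ, Cn m) e x v
  (∑ μ, ∑ ν, ∑ γ, ∑ δ, h.chernCurvature e (e x) μ ν γ δ
    * W μ * conj (W ν) * W γ * conj (W δ)).re / (h.form x v v).re ^ 2

/-- Positive holomorphic sectional curvature. -/
def PosHSC (h : HermitianMetric m M) : Prop :=
  ∀ (x : M) (v : TangentSpace 𝓘(ℂ, Cn m) x), v ≠ 0 → 0 < h.holSectCurv x v

/-- Non-negative holomorphic sectional curvature. -/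
def NonnegHSC (h : HermitianMetric m M) : Prop :=
  ∀ (x : M) (v : TangentSpace 𝓘(ℂ, Cn m) x), v ≠ 0 → 0 ≤ h.holSectCurv x v

/-- Negative holomorphic sectional curvature. -/
def NegHSC (h : HermitianMetric m M) : Prop :=
  ∀ (x : M) (v : TangentSpace 𝓘(ℂ, Cn m) x), v ≠ 0 → h.holSectCurv x v < 0

/-- Non-positive holomorphic sectional curvature. -/
def NonposHSC (h : HermitianMetric m M) : Prop :=
  ∀ (x : M) (v : TangentSpace 𝓘(ℂ, Cn m) x), v ≠ 0 → h.holSectCurv x v ≤ 0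

end HermitianMetric

end HermitianGeometry

end

/-!
# Holomorphic maps and holomorphic sectional curvature

The proof is a maximum principle for the energy density `|df(v)|² / |v|²`, a function of the
nonzero tangent vectors `v` of `M`. As `M` is compact it has a maximum `λ`, attained at some `v₁`
over `x₁` (`exists_max_energy`). If `λ = 0` then `df = 0` and `f` is constant
(`isLocallyConstant_of_diffMap_eq_zero`).

If `λ > 0`, let `W` be the coordinates of `v₁`, and let `c` be a holomorphic curve through `x₁`
with velocity `W` and acceleration `A` at `t = 0`. In coordinates,
`∂∂̄ |c'|² = - R(W, W̄, W, W̄) + |A + B|²` at `t = 0`, where `B` is the vector with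
`h(B, ∂_β) = ∂_μ h_{γβ̄} W^μ W^γ` (`exists_hasJet_hermForm`, `hessTerm_add_eq`). For the curve with
`A = -B` the square vanishes, while for the curve `f ∘ c` in `N` it is non-negative. The function
`|(f ∘ c)'|² - λ |c'|²` is non-positive and vanishes at `t = 0`, so that its Laplacian there is
non-positive. Hence `λ R^M(W, W̄, W, W̄) ≤ R^N(W', W̄', W', W̄')` with `W' = df(W) ≠ 0`
(`mul_curvValue_le`, `mul_holSectCurv_le`), against either of the curvature hypotheses.

Working with the preferred charts at `x₁` and `f x₁` throughout makes it unnecessary to know that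
the curvature is a tensor.
-/

open Filter Topology

namespace HermitianGeometry

/-! ### Second-order jets of curves -/

/-- The curve `f` is differentiable near `0` and twice differentiable at `0`, with value `a`,
first derivative `b` and second derivative `c` there. -/
def HasJet {E : Type*} [NormedAddCommGroup E] [NormedSpace ℝ E] (f : ℝ → E) (a b c : E) : Prop :=
  ∃ f' : ℝ → E, (∀ᶠ s in 𝓝 0, HasDerivAt f (f' s) s) ∧ HasDerivAt f' c 0 ∧ f 0 = a ∧ f' 0 = b

namespace HasJet

variable {E F : Type*} [NormedAddCommGroup E] [NormedSpace ℝ E]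
  [NormedAddCommGroup F] [NormedSpace ℝ F]

theorem sub {f g : ℝ → E} {a b c a' b' c' : E} (hf : HasJet f a b c) (hg : HasJet g a' b' c') :
    HasJet (fun s => f s - g s) (a - a') (b - b') (c - c') := by
  obtain ⟨f', h1, h2, rfl, rfl⟩ := hf
  obtain ⟨g', k1, k2, rfl, rfl⟩ := hg
  refine ⟨fun s => f' s - g' s, ?_, h2.sub k2, rfl, rfl⟩
  filter_upwards [h1, k1] with s u v using u.sub v

theorem sum {ι : Type*} (t : Finset ι) {f : ι → ℝ → E} {a b c : ι → E}
    (h : ∀ i ∈ t, HasJet (f i) (a i) (b i) (c i)) :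
    HasJet (fun s => ∑ i ∈ t, f i s) (∑ i ∈ t, a i) (∑ i ∈ t, b i) (∑ i ∈ t, c i) := by
  choose! f' h1 h2 h3 h4 using h
  refine ⟨fun s => ∑ i ∈ t, f' i s, ?_, HasDerivAt.fun_sum h2, Finset.sum_congr rfl h3,
    Finset.sum_congr rfl h4⟩
  filter_upwards [(Finset.eventually_all t).2 h1] with s hs using HasDerivAt.fun_sum hs

theorem mul {f g : ℝ → ℂ} {a b c a' b' c' : ℂ} (hf : HasJet f a b c) (hg : HasJet g a' b' c') :
    HasJet (fun s => f s * g s) (a * a') (b * a' + a * b') (c * a' + 2 * (b * b') + a * c') := by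
  obtain ⟨f', h1, h2, rfl, rfl⟩ := hf
  obtain ⟨g', k1, k2, rfl, rfl⟩ := hg
  refine ⟨fun s => f' s * g s + f s * g' s, ?_, ?_, rfl, rfl⟩
  · filter_upwards [h1, k1] with s u v using u.mul v
  · refine ((h2.mul k1.self_of_nhds).add (h1.self_of_nhds.mul k2)).congr_deriv ?_
    ring

theorem clm_comp (L : E →L[ℝ] F) {f : ℝ → E} {a b c : E} (hf : HasJet f a b c) :
    HasJet (fun s => L (f s)) (L a) (L b) (L c) := by
  obtain ⟨f', h1, h2, rfl, rfl⟩ := hf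
  refine ⟨fun s => L (f' s), ?_, L.hasFDerivAt.comp_hasDerivAt 0 h2, rfl, rfl⟩
  filter_upwards [h1] with s u using L.hasFDerivAt.comp_hasDerivAt s u

theorem re {f : ℝ → ℂ} {a b c : ℂ} (h : HasJet f a b c) :
    HasJet (fun s => (f s).re) a.re b.re c.re :=
  h.clm_comp Complex.reCLM

theorem comp {k : E → F} {f : ℝ → E} {a b c : E} (hk : ContDiffAt ℝ 2 k a)
    (hf : HasJet f a b c) :
    HasJet (fun s => k (f s)) (k a) (fderiv ℝ k a b)
      (fderiv ℝ (fderiv ℝ k) a b b + fderiv ℝ k a c) := by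
  obtain ⟨f', h1, h2, rfl, rfl⟩ := hf
  have hcont : ContinuousAt f 0 := h1.self_of_nhds.continuousAt
  refine ⟨fun s => fderiv ℝ k (f s) (f' s), ?_, ?_, rfl, rfl⟩
  · filter_upwards [h1, hcont.eventually (hk.eventually (by simp))] with s u v
    exact (v.differentiableAt (by simp)).hasFDerivAt.comp_hasDerivAt s u
  · have hd : DifferentiableAt ℝ (fderiv ℝ k) (f 0) :=
      (hk.fderiv_right (m := 1) (by norm_num)).differentiableAt (by simp)
    exact (hd.hasFDerivAt.comp_hasDerivAt (0 : ℝ) h1.self_of_nhds).clm_apply h2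

/-- Second derivative test. -/
theorem nonpos_of_isLocalMax {f : ℝ → ℝ} {a b c : ℝ} (h : HasJet f a b c)
    (hmax : IsLocalMax f 0) : c ≤ 0 := by
  obtain ⟨f', h1, h2, rfl, rfl⟩ := h
  by_contra! hc
  have hderiv : deriv f =ᶠ[𝓝 0] f' := by
    filter_upwards [h1] with s hs using hs.deriv
  have hmin : IsLocalMin f 0 := by
    refine isLocalMin_of_deriv_deriv_pos ?_ hmax.deriv_eq_zero h1.self_of_nhds.continuousAt
    rw [hderiv.deriv_eq, h2.deriv]
    exact hc
  have hconst : f =ᶠ[𝓝 0] fun _ => f 0 := by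
    filter_upwards [hmax, hmin] with s u v using le_antisymm u v
  have hzero : f' =ᶠ[𝓝 0] fun _ => 0 := by
    filter_upwards [hderiv, hconst.eventuallyEq_nhds] with s u v
    rw [← u, v.deriv_eq, deriv_const]
  have := (h2.congr_of_eventuallyEq hzero.symm).unique (hasDerivAt_const 0 (0 : ℝ))
  exact hc.ne' this

/-- The restriction of a holomorphic curve to the real line in the direction `ε`. -/
theorem of_holomorphic {E : Type*} [NormedAddCommGroup E] [NormedSpace ℂ E] [CompleteSpace E]
    {c : ℂ → E} (hc : ∀ᶠ t in 𝓝 0, DifferentiableAt ℂ c t) (ε : ℂ) :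
    HasJet (fun s : ℝ => c (s * ε)) (c 0) (ε • deriv c 0) (ε ^ 2 • deriv (deriv c) 0) := by
  have han : AnalyticAt ℂ c 0 := Complex.analyticAt_iff_eventually_differentiableAt.2 hc
  have hline : ∀ s : ℝ, HasDerivAt (fun s : ℝ => (s : ℂ) * ε) ε s := fun s => by
    simpa using (Complex.ofRealCLM.hasDerivAt (x := s)).mul_const ε
  have hlim : Tendsto (fun s : ℝ => (s : ℂ) * ε) (𝓝 0) (𝓝 0) := by
    simpa using (hline 0).continuousAt.tendsto
  refine ⟨fun s => ε • deriv c (s * ε), ?_, ?_, by simp, by simp⟩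
  · filter_upwards [hlim.eventually hc] with s hs
    exact hs.hasDerivAt.scomp s (hline s)
  · have h2 : HasDerivAt (deriv c) (deriv (deriv c) 0) ((0 : ℝ) * ε : ℂ) := by
      simpa using han.deriv.differentiableAt.hasDerivAt
    have := (h2.scomp (0 : ℝ) (hline 0)).const_smul ε
    rw [pow_two, mul_smul]
    exact this

end HasJet

/-! ### Wirtinger derivatives -/

/-- A real-linear map on `ℂ^m` for which multiplication by `i` acts as multiplication by `τ` is
determined by its values on the standard basis; `τ = i` and `τ = -i` are the complex linear and
the conjugate linear case. -/
theorem realLinear_eq_sum {m : ℕ} (T : Cn m →L[ℝ] ℂ) (τ : ℂ)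
    (hT : ∀ u, T (Complex.I • u) = τ * T u) (W : Cn m) :
    T W = ∑ μ, T (EuclideanSpace.single μ (1 : ℂ)) * ((W μ).re + (W μ).im * τ) := by
  have hW : W = ∑ μ, ((W μ).re • EuclideanSpace.single μ (1 : ℂ)
      + (W μ).im • (Complex.I • EuclideanSpace.single μ (1 : ℂ)) : Cn m) := by
    ext i
    simp [Pi.single_apply, Finset.sum_add_distrib]
  conv_lhs => rw [hW]
  rw [map_sum]
  refine Finset.sum_congr rfl fun μ _ => ?_
  rw [map_add, map_smul, map_smul, hT]
  simp only [Complex.real_smul]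
  ring

theorem single_I {m : ℕ} (μ : Fin m) :
    (EuclideanSpace.single μ Complex.I : Cn m) = Complex.I • EuclideanSpace.single μ (1 : ℂ) := by
  ext i
  simp

theorem I_smul_I_smul {m : ℕ} (u : Cn m) : Complex.I • Complex.I • u = -u := by
  rw [smul_smul, Complex.I_mul_I, neg_one_smul]

theorem sum_dz_mul {m : ℕ} (k : Cn m → ℂ) (z W : Cn m) :
    ∑ μ, dz μ k z * W μ
      = (1 / 2 : ℂ) * (fderiv ℝ k z W - Complex.I * fderiv ℝ k z (Complex.I • W)) := by
  set L := fderiv ℝ k z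
  let J : Cn m →L[ℝ] Cn m := (Complex.I • ContinuousLinearMap.id ℂ (Cn m)).restrictScalars ℝ
  have key := realLinear_eq_sum (L - Complex.I • (L.comp J)) Complex.I (fun u => by
    simp [J, I_smul_I_smul]
    linear_combination L (Complex.I • u) * Complex.I_sq) W
  simp only [Complex.re_add_im] at key
  simp only [J, FunLike.coe_sub, FunLike.coe_smul, Pi.sub_apply,
    Pi.smul_apply, ContinuousLinearMap.comp_apply, smul_eq_mul,
    ContinuousLinearMap.coe_restrictScalars', ContinuousLinearMap.coe_id', id] at key
  rw [key, Finset.mul_sum]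
  refine Finset.sum_congr rfl fun μ _ => ?_
  rw [dz, single_I]
  ring

theorem sum_dzbar_mul {m : ℕ} (k : Cn m → ℂ) (z W : Cn m) :
    ∑ μ, dzbar μ k z * conj (W μ)
      = (1 / 2 : ℂ) * (fderiv ℝ k z W + Complex.I * fderiv ℝ k z (Complex.I • W)) := by
  set L := fderiv ℝ k z
  let J : Cn m →L[ℝ] Cn m := (Complex.I • ContinuousLinearMap.id ℂ (Cn m)).restrictScalars ℝ
  have key := realLinear_eq_sum (L + Complex.I • (L.comp J)) (-Complex.I) (fun u => by
    simp [J, I_smul_I_smul]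
    linear_combination L (Complex.I • u) * Complex.I_sq) W
  have hconj : ∀ a : ℂ, (a.re : ℂ) + a.im * (-Complex.I) = conj a := fun a => by
    apply Complex.ext <;> simp
  simp only [hconj] at key
  simp only [J, FunLike.coe_add, FunLike.coe_smul, Pi.add_apply,
    Pi.smul_apply, ContinuousLinearMap.comp_apply, smul_eq_mul,
    ContinuousLinearMap.coe_restrictScalars', ContinuousLinearMap.coe_id', id] at key
  rw [key, Finset.mul_sum]
  refine Finset.sum_congr rfl fun μ _ => ?_
  rw [dzbar, single_I]
  ring

/-- The complex Hessian of `k` in the direction `W` is a quarter of the Laplacian of `k` along the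
complex line spanned by `W`. -/
theorem sum_dz_dzbar_mul {m : ℕ} {k : Cn m → ℂ} {z : Cn m} (hk : ContDiffAt ℝ 2 k z)
    (W : Cn m) :
    ∑ μ, ∑ ν, dz μ (dzbar ν k) z * W μ * conj (W ν)
      = (1 / 4 : ℂ) * (fderiv ℝ (fderiv ℝ k) z W W
        + fderiv ℝ (fderiv ℝ k) z (Complex.I • W) (Complex.I • W)) := by
  have hd : DifferentiableAt ℝ (fderiv ℝ k) z :=
    (hk.fderiv_right (m := 1) (by norm_num)).differentiableAt (by simp)
  have hsymm : IsSymmSndFDerivAt ℝ k z := hk.isSymmSndFDerivAt (by simp)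
  set D := fderiv ℝ (fderiv ℝ k) z with hD
  have hpart : ∀ u : Cn m, HasFDerivAt (fun w => fderiv ℝ k w u) (D.flip u) z := fun u => by
    simpa using hd.hasFDerivAt.clm_apply (hasFDerivAt_const u z)
  have hbar : ∀ ν, DifferentiableAt ℝ (dzbar ν k) z := fun ν =>
    ((hpart _).differentiableAt.add
      ((hpart _).differentiableAt.const_mul Complex.I)).const_mul (1 / 2 : ℂ)
  have hG : HasFDerivAt (fun w => ∑ ν, dzbar ν k w * conj (W ν))
      ((1 / 2 : ℂ) • (D.flip W + Complex.I • D.flip (Complex.I • W))) z := by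
    simp only [sum_dzbar_mul]
    exact ((hpart W).add ((hpart (Complex.I • W)).const_mul Complex.I)).const_mul (1 / 2 : ℂ)
  have hswap : ∀ μ, ∑ ν, dz μ (dzbar ν k) z * conj (W ν)
      = dz μ (fun w => ∑ ν, dzbar ν k w * conj (W ν)) z := fun μ => by
    have hs : fderiv ℝ (fun w => ∑ ν, dzbar ν k w * conj (W ν)) z
        = ∑ ν, conj (W ν) • fderiv ℝ (dzbar ν k) z := by
      rw [fderiv_fun_sum fun ν _ => (hbar ν).mul_const _]
      exact Finset.sum_congr rfl fun ν _ => fderiv_mul_const (hbar ν) _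
    simp only [dz, hs, _root_.sum_apply, _root_.smul_apply, smul_eq_mul,
      Finset.mul_sum, ← Finset.sum_sub_distrib]
    exact Finset.sum_congr rfl fun ν _ => by ring
  calc ∑ μ, ∑ ν, dz μ (dzbar ν k) z * W μ * conj (W ν)
      = ∑ μ, dz μ (fun w => ∑ ν, dzbar ν k w * conj (W ν)) z * W μ := by
        refine Finset.sum_congr rfl fun μ _ => ?_
        rw [← hswap, Finset.sum_mul]
        exact Finset.sum_congr rfl fun ν _ => by ring
    _ = _ := by
        rw [sum_dz_mul, hG.fderiv]
        have := hsymm.eq W (Complex.I • W)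
        rw [← hD] at this
        simp only [_root_.smul_apply, _root_.add_apply,
          ContinuousLinearMap.flip_apply, smul_eq_mul, this]
        linear_combination (-(1 / 4 : ℂ) * D (Complex.I • W) (Complex.I • W)) * Complex.I_sq

theorem dzbar_conj {m : ℕ} {k : Cn m → ℂ} {z : Cn m} (hk : DifferentiableAt ℝ k z) (μ : Fin m) :
    dzbar μ (fun w => conj (k w)) z = conj (dz μ k z) := by
  have : fderiv ℝ (fun w => conj (k w)) z
      = (Complex.conjCLE : ℂ →L[ℝ] ℂ).comp (fderiv ℝ k z) :=
    ((Complex.conjCLE : ℂ →L[ℝ] ℂ).hasFDerivAt.comp z hk.hasFDerivAt).fderiv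
  simp [dzbar, dz, this, Complex.conj_ofNat]

/-! ### Curvature as a Laplacian along holomorphic curves -/

/-- The sesquilinear form on `ℂ^m` with matrix `A`, linear in the first argument. -/
noncomputable def hermForm {m : ℕ} (A : Matrix (Fin m) (Fin m) ℂ) (u v : Cn m) : ℂ :=
  ∑ α, ∑ β, A α β * u α * conj (v β)

/-- The value `R_{μν̄γδ̄} W^μ W̄^ν W^γ W̄^δ` of the Chern curvature of a matrix-valued function `H`
on `ℂ^m`, regarded as the components of a Hermitian metric. -/
noncomputable def curvValue {m : ℕ} (H : Cn m → Matrix (Fin m) (Fin m) ℂ) (z W : Cn m) : ℂ :=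
  ∑ μ, ∑ ν, ∑ γ, ∑ δ, (- dz μ (dzbar ν fun w => H w γ δ) z
    + ∑ α, ∑ β, (H z)⁻¹ β α * dz μ (fun w => H w γ β) z * dzbar ν (fun w => H w α δ) z)
    * W μ * conj (W ν) * W γ * conj (W δ)

/-- The Hessian term `∂_μ ∂_ν̄ h_{γδ̄} W^μ W̄^ν W^γ W̄^δ`. -/
noncomputable def hessTerm {m : ℕ} (H : Cn m → Matrix (Fin m) (Fin m) ℂ) (z W : Cn m) : ℂ :=
  ∑ γ, ∑ δ, (∑ μ, ∑ ν, dz μ (dzbar ν fun w => H w γ δ) z * W μ * conj (W ν)) * W γ * conj (W δ)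

/-- The covector `∂_μ h_{γβ̄} W^μ W^γ`. -/
noncomputable def dzTerm {m : ℕ} (H : Cn m → Matrix (Fin m) (Fin m) ℂ) (z W : Cn m)
    (β : Fin m) : ℂ :=
  ∑ γ, (∑ μ, dz μ (fun w => H w γ β) z * W μ) * W γ

/-- The covector `∂_ν̄ h_{αδ̄} W̄^ν W̄^δ`. -/
noncomputable def dzbarTerm {m : ℕ} (H : Cn m → Matrix (Fin m) (Fin m) ℂ) (z W : Cn m)
    (α : Fin m) : ℂ :=
  ∑ δ, (∑ ν, dzbar ν (fun w => H w α δ) z * conj (W ν)) * conj (W δ)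

/-- The vector dual to `dzTerm` with respect to the metric: `-christoffelVec H z W` is the second
derivative at `z` of a holomorphic curve with velocity `W` whose covariant acceleration for the
Chern connection vanishes there. -/
noncomputable def christoffelVec {m : ℕ} (H : Cn m → Matrix (Fin m) (Fin m) ℂ)
    (z W : Cn m) : Cn m :=
  WithLp.toLp 2 fun α => ∑ β, (H z)⁻¹ β α * dzTerm H z W β

/-- The curvature value is minus the Hessian term plus the squared length of the vector dual to
`dzTerm`, the latter written as a pairing. -/
theorem curvValue_eq {m : ℕ} (H : Cn m → Matrix (Fin m) (Fin m) ℂ) (z W : Cn m) :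
    curvValue H z W
      = - hessTerm H z W + ∑ α, christoffelVec H z W α * dzbarTerm H z W α := by
  have hhess : ∑ μ, ∑ ν, ∑ γ, ∑ δ, dz μ (dzbar ν fun w => H w γ δ) z
      * W μ * conj (W ν) * W γ * conj (W δ) = hessTerm H z W := by
    simp only [hessTerm, Finset.sum_mul]
    rw [Finset.sum_comm_cycle]
    refine Finset.sum_congr rfl fun μ _ => ?_
    rw [Finset.sum_comm_cycle]
  have hquad : ∑ μ, ∑ ν, ∑ γ, ∑ δ, (∑ α, ∑ β, (H z)⁻¹ β α * dz μ (fun w => H w γ β) z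
      * dzbar ν (fun w => H w α δ) z) * W μ * conj (W ν) * W γ * conj (W δ)
      = ∑ α, christoffelVec H z W α * dzbarTerm H z W α := by
    have hfactor : ∀ α, christoffelVec H z W α * dzbarTerm H z W α
        = ∑ β, ∑ μ, ∑ ν, ∑ γ, ∑ δ, (H z)⁻¹ β α * dz μ (fun w => H w γ β) z
          * dzbar ν (fun w => H w α δ) z * W μ * conj (W ν) * W γ * conj (W δ) := fun α => by
      simp only [christoffelVec, Finset.sum_mul]
      refine Finset.sum_congr rfl fun β _ => ?_
      rw [dzTerm, dzbarTerm, mul_assoc]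
      simp only [Finset.sum_mul]
      rw [Finset.sum_comm, Finset.mul_sum]
      simp only [Finset.mul_sum]
      refine Finset.sum_congr rfl fun μ _ => ?_
      rw [Finset.sum_comm_cycle]
      refine Finset.sum_congr rfl fun ν _ => Finset.sum_congr rfl fun γ _ =>
        Finset.sum_congr rfl fun δ _ => ?_
      ring
    have hcycle : ∀ X : Fin m → Fin m → Fin m → Fin m → Fin m → ℂ,
        ∑ μ, ∑ ν, ∑ γ, ∑ δ, ∑ α, X μ ν γ δ α = ∑ α, ∑ μ, ∑ ν, ∑ γ, ∑ δ, X μ ν γ δ α := by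
      intro X
      rw [← Finset.sum_comm_cycle (f := fun μ ν α => ∑ γ, ∑ δ, X μ ν γ δ α)]
      refine Finset.sum_congr rfl fun μ _ => Finset.sum_congr rfl fun ν _ => ?_
      rw [Finset.sum_comm_cycle]
    simp only [hfactor, Finset.sum_mul]
    rw [hcycle]
    refine Finset.sum_congr rfl fun α _ => ?_
    rw [hcycle]
  rw [← hhess, ← hquad]
  simp only [curvValue, ← Finset.sum_neg_distrib, ← Finset.sum_add_distrib]
  refine Finset.sum_congr rfl fun μ _ => Finset.sum_congr rfl fun ν _ =>
    Finset.sum_congr rfl fun γ _ => Finset.sum_congr rfl fun δ _ => ?_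
  ring

theorem hermForm_add_add {m : ℕ} (A : Matrix (Fin m) (Fin m) ℂ) (u v : Cn m) :
    hermForm A (u + v) (u + v)
      = hermForm A u u + hermForm A u v + hermForm A v u + hermForm A v v := by
  simp only [hermForm, ← Finset.sum_add_distrib]
  refine Finset.sum_congr rfl fun α _ => Finset.sum_congr rfl fun β _ => ?_
  simp only [PiLp.add_apply, map_add]
  ring

theorem hermForm_zero_left {m : ℕ} (A : Matrix (Fin m) (Fin m) ℂ) (v : Cn m) :
    hermForm A 0 v = 0 := by
  simp [hermForm]

theorem hermForm_smul_smul {m : ℕ} (A : Matrix (Fin m) (Fin m) ℂ) (r : ℝ) (u : Cn m) :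
    (hermForm A (r • u) (r • u)).re = r ^ 2 * (hermForm A u u).re := by
  have : hermForm A (r • u) (r • u) = (r ^ 2 : ℝ) * hermForm A u u := by
    simp only [hermForm, Finset.mul_sum]
    refine Finset.sum_congr rfl fun α _ => Finset.sum_congr rfl fun β _ => ?_
    simp only [PiLp.smul_apply, Complex.real_smul, map_mul, Complex.conj_ofReal]
    push_cast
    ring
  rw [this, Complex.re_ofReal_mul]

theorem conj_hermForm {m : ℕ} {A : Matrix (Fin m) (Fin m) ℂ} (hA : ∀ α β, conj (A α β) = A β α)
    (u v : Cn m) : conj (hermForm A u v) = hermForm A v u := by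
  rw [hermForm, hermForm, Finset.sum_comm]
  simp only [map_sum, map_mul, hA, Complex.conj_conj]
  refine Finset.sum_congr rfl fun α _ => Finset.sum_congr rfl fun β _ => ?_
  ring

/-- A matrix with definite sesquilinear form is invertible. -/
theorem isUnit_of_hermForm_ne_zero {m : ℕ} {A : Matrix (Fin m) (Fin m) ℂ}
    (hA : ∀ u : Cn m, u ≠ 0 → hermForm A u u ≠ 0) : IsUnit A := by
  rw [← Matrix.vecMul_injective_iff_isUnit]
  refine (injective_iff_map_eq_zero A.vecMulLinear).2 fun u hu => ?_
  by_contra hne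
  refine hA (WithLp.toLp 2 u) (fun h => hne (by simpa using h)) ?_
  have hsum : ∀ β, ∑ α, u α * A α β = 0 := fun β => by
    simpa [Matrix.vecMul, dotProduct] using congrFun hu β
  rw [hermForm, Finset.sum_comm]
  refine Finset.sum_eq_zero fun β _ => ?_
  rw [← Finset.sum_mul]
  simp [mul_comm (A _ _), hsum]

theorem hermForm_christoffelVec {m : ℕ} {H : Cn m → Matrix (Fin m) (Fin m) ℂ} {z : Cn m}
    (hH : IsUnit (H z)) (W v : Cn m) :
    hermForm (H z) (christoffelVec H z W) v = ∑ β, dzTerm H z W β * conj (v β) := by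
  have hB : ∀ β, ∑ α, christoffelVec H z W α * H z α β = dzTerm H z W β := fun β => by
    have h1 : (H z)⁻¹ * H z = 1 :=
      Matrix.nonsing_inv_mul _ ((Matrix.isUnit_iff_isUnit_det _).1 hH)
    have h2 : Matrix.vecMul (Matrix.vecMul (fun β => dzTerm H z W β) (H z)⁻¹) (H z)
        = fun β => dzTerm H z W β := by
      rw [Matrix.vecMul_vecMul, h1, Matrix.vecMul_one]
    simpa [Matrix.vecMul, dotProduct, christoffelVec, mul_comm] using congrFun h2 β
  rw [hermForm, Finset.sum_comm]
  refine Finset.sum_congr rfl fun β _ => ?_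
  rw [← hB β, Finset.sum_mul]
  exact Finset.sum_congr rfl fun α _ => by ring

theorem conj_dzTerm {m : ℕ} {H : Cn m → Matrix (Fin m) (Fin m) ℂ} {z : Cn m}
    (hd : ∀ α β, DifferentiableAt ℝ (fun w => H w α β) z)
    (hherm : ∀ᶠ w in 𝓝 z, ∀ α β, conj (H w α β) = H w β α) (W : Cn m) (α : Fin m) :
    conj (dzTerm H z W α) = dzbarTerm H z W α := by
  have hk : ∀ γ μ, conj (dz μ (fun w => H w γ α) z) = dzbar μ (fun w => H w α γ) z := by
    intro γ μ
    have : (fun w => conj (H w γ α)) =ᶠ[𝓝 z] fun w => H w α γ := by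
      filter_upwards [hherm] with w hw using hw γ α
    rw [← dzbar_conj (hd γ α), dzbar, dzbar, this.fderiv_eq]
  simp [dzTerm, dzbarTerm, hk]

/-- Completing the square in the acceleration `A` of a holomorphic curve. -/
theorem hessTerm_add_eq {m : ℕ} {H : Cn m → Matrix (Fin m) (Fin m) ℂ} {z : Cn m}
    (hd : ∀ α β, DifferentiableAt ℝ (fun w => H w α β) z)
    (hherm : ∀ᶠ w in 𝓝 z, ∀ α β, conj (H w α β) = H w β α)
    (hpos : ∀ u : Cn m, u ≠ 0 → 0 < (hermForm (H z) u u).re) (W A : Cn m) :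
    hessTerm H z W + ∑ α, dzbarTerm H z W α * A α + ∑ β, dzTerm H z W β * conj (A β)
        + hermForm (H z) A A
      = - curvValue H z W
        + hermForm (H z) (A + christoffelVec H z W) (A + christoffelVec H z W) := by
  set B := christoffelVec H z W with hBdef
  have hunit : IsUnit (H z) := isUnit_of_hermForm_ne_zero fun u hu h0 => by
    have := hpos u hu
    simp [h0] at this
  have hB : ∀ v, hermForm (H z) B v = ∑ β, dzTerm H z W β * conj (v β) :=
    hermForm_christoffelVec hunit W
  have hB' : ∀ v, hermForm (H z) v B = ∑ α, v α * dzbarTerm H z W α := fun v => by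
    rw [← conj_hermForm hherm.self_of_nhds, hB]
    simp [conj_dzTerm hd hherm, mul_comm]
  rw [hermForm_add_add, hB A, hB' A, hB' B, curvValue_eq, ← hBdef]
  simp only [mul_comm (A _)]
  ring

/-- Along a holomorphic curve `c` the squared speed has a second-order jet in every real
direction `ε`, and the sum of the second derivatives in the directions `1` and `i` is `4 ∂∂̄`. -/
theorem exists_hasJet_hermForm {m : ℕ} {H : Cn m → Matrix (Fin m) (Fin m) ℂ} {c : ℂ → Cn m}
    (hH : ∀ α β, ContDiffAt ℝ 2 (fun w => H w α β) (c 0))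
    (hc : ∀ᶠ t in 𝓝 0, DifferentiableAt ℂ c t) :
    ∃ b J : ℂ → ℂ, (∀ ε : ℂ, HasJet
      (fun s : ℝ => hermForm (H (c (s * ε))) (deriv c (s * ε)) (deriv c (s * ε)))
      (hermForm (H (c 0)) (deriv c 0) (deriv c 0)) (b ε) (J ε)) ∧
      J 1 + J Complex.I = 4 * (hessTerm H (c 0) (deriv c 0)
        + ∑ α, dzbarTerm H (c 0) (deriv c 0) α * deriv (deriv c) 0 α
        + ∑ β, dzTerm H (c 0) (deriv c 0) β * conj (deriv (deriv c) 0 β)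
        + hermForm (H (c 0)) (deriv (deriv c) 0) (deriv (deriv c) 0)) := by
  have han : AnalyticAt ℂ c 0 := Complex.analyticAt_iff_eventually_differentiableAt.2 hc
  have hc' : ∀ᶠ t in 𝓝 0, DifferentiableAt ℂ (deriv c) t :=
    Complex.analyticAt_iff_eventually_differentiableAt.1 han.deriv
  have hcoord : ∀ (ε : ℂ) (α : Fin m), HasJet (fun s : ℝ => deriv c (s * ε) α) (deriv c 0 α)
      (ε * deriv (deriv c) 0 α) (ε ^ 2 * deriv (deriv (deriv c)) 0 α) := fun ε α =>
    (HasJet.of_holomorphic hc' ε).clm_comp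
      ((EuclideanSpace.proj α : Cn m →L[ℂ] ℂ).restrictScalars ℝ)
  have hconj : ∀ (ε : ℂ) (β : Fin m), HasJet (fun s : ℝ => conj (deriv c (s * ε) β)) _ _ _ :=
    fun ε β => (hcoord ε β).clm_comp (Complex.conjCLE : ℂ →L[ℝ] ℂ)
  have hjet := fun ε : ℂ => HasJet.sum Finset.univ fun (α : Fin m) _ =>
    HasJet.sum Finset.univ fun (β : Fin m) _ =>
    ((HasJet.comp (hH α β) (HasJet.of_holomorphic hc ε)).mul (hcoord ε α)).mul (hconj ε β)
  refine ⟨_, _, fun ε => hjet ε, ?_⟩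
  set z := c 0
  set W := deriv c 0
  set A := deriv (deriv c) 0
  have hdzbar : ∑ α, dzbarTerm H z W α * A α
      = ∑ α, ∑ β, (∑ ν, dzbar ν (fun w => H w α β) z * conj (W ν)) * conj (W β) * A α := by
    simp only [dzbarTerm, Finset.sum_mul]
  have hdz : ∑ β, dzTerm H z W β * conj (A β)
      = ∑ α, ∑ β, (∑ ν, dz ν (fun w => H w α β) z * W ν) * W α * conj (A β) := by
    rw [Finset.sum_comm]
    simp only [dzTerm, Finset.sum_mul]
  rw [hdzbar, hdz, hessTerm, hermForm]
  simp only [← Finset.sum_add_distrib]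
  rw [Finset.mul_sum]
  refine Finset.sum_congr rfl fun α _ => ?_
  rw [Finset.mul_sum]
  refine Finset.sum_congr rfl fun β _ => ?_
  rw [sum_dz_mul, sum_dzbar_mul, sum_dz_dzbar_mul (hH α β)]
  simp only [one_smul, one_pow, one_mul, Complex.I_sq, neg_smul, map_neg, neg_mul,
    ContinuousLinearEquiv.coe_coe, Complex.conjCLE_apply, map_mul, Complex.conj_I]
  linear_combination (-2 * A α * H z α β * conj (A β)) * Complex.I_sq

/-- Schwarz lemma at a maximum of the energy density: if the quotient of the pulled back metric
`F^*G` by `H`, as a function on the nonzero tangent vectors, has the maximum `lam`, attained at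
`W`, then the curvatures in the directions `W` and `dF(W)` compare. -/
theorem mul_curvValue_le {m n : ℕ} {H : Cn m → Matrix (Fin m) (Fin m) ℂ}
    {G : Cn n → Matrix (Fin n) (Fin n) ℂ} {F : Cn m → Cn n} {z W : Cn m} {lam : ℝ}
    (hH : ∀ α β, ContDiffAt ℝ 2 (fun w => H w α β) z)
    (hHherm : ∀ᶠ w in 𝓝 z, ∀ α β, conj (H w α β) = H w β α)
    (hHpos : ∀ u : Cn m, u ≠ 0 → 0 < (hermForm (H z) u u).re)
    (hG : ∀ α β, ContDiffAt ℝ 2 (fun w => G w α β) (F z))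
    (hGherm : ∀ᶠ w in 𝓝 (F z), ∀ α β, conj (G w α β) = G w β α)
    (hGpos : ∀ u : Cn n, u ≠ 0 → 0 < (hermForm (G (F z)) u u).re)
    (hF : ∀ᶠ w in 𝓝 z, DifferentiableAt ℂ F w)
    (hle : ∀ᶠ w in 𝓝 z, ∀ u : Cn m,
      (hermForm (G (F w)) (fderiv ℂ F w u) (fderiv ℂ F w u)).re ≤ lam * (hermForm (H w) u u).re)
    (heq : (hermForm (G (F z)) (fderiv ℂ F z W) (fderiv ℂ F z W)).re
      = lam * (hermForm (H z) W W).re) :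
    lam * (curvValue H z W).re ≤ (curvValue G (F z) (fderiv ℂ F z W)).re := by
  set A : Cn m := - christoffelVec H z W with hA
  -- The curve through `z` with velocity `W` whose acceleration cancels the Christoffel term.
  set c : ℂ → Cn m := fun t => z + (t • W + (t ^ 2 / 2) • A) with hcdef
  have hc : ∀ t, HasDerivAt c (W + t • A) t := fun t => by
    have h2 : HasDerivAt (fun t : ℂ => t ^ 2 / 2) t t := by
      refine ((hasDerivAt_pow 2 t).div_const 2).congr_deriv ?_
      simp
    have h1 := (hasDerivAt_id t).smul_const W
    rw [one_smul] at h1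
    exact (h1.add (h2.smul_const A)).const_add z
  have hc' : deriv c = fun t => W + t • A := funext fun t => (hc t).deriv
  have hc0 : c 0 = z := by simp [hcdef]
  have hdc0 : deriv c 0 = W := by simp [hc']
  have hddc0 : deriv (deriv c) 0 = A := by
    rw [hc']
    have h1 := ((hasDerivAt_id (0 : ℂ)).smul_const A).const_add W
    rw [one_smul] at h1
    exact h1.deriv
  have hclim : Tendsto c (𝓝 0) (𝓝 z) := by
    simpa [hc0] using (hc 0).continuousAt.tendsto
  have hcF : ∀ᶠ t in 𝓝 0, HasDerivAt (fun t => F (c t)) (fderiv ℂ F (c t) (deriv c t)) t := by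
    filter_upwards [hclim.eventually hF] with t ht
    exact ht.hasFDerivAt.comp_hasDerivAt t (by rw [(hc t).deriv]; exact hc t)
  have hdcF0 : deriv (fun t => F (c t)) 0 = fderiv ℂ F z W := by
    rw [hcF.self_of_nhds.deriv, hc0, hdc0]
  obtain ⟨b₁, J₁, hJ₁, hsum₁⟩ := exists_hasJet_hermForm (H := H) (c := c) (by rwa [hc0])
    (Eventually.of_forall fun t => (hc t).differentiableAt)
  obtain ⟨b₂, J₂, hJ₂, hsum₂⟩ := exists_hasJet_hermForm (H := G) (c := fun t => F (c t))
    (by rwa [hc0]) (hcF.mono fun t ht => ht.differentiableAt)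
  have hJ : ∀ ε : ℂ, (J₂ ε).re - lam * (J₁ ε).re ≤ 0 := fun ε => by
    refine ((hJ₂ ε).re.sub ((hJ₁ ε).re.clm_comp (lam • ContinuousLinearMap.id ℝ ℝ))
      ).nonpos_of_isLocalMax ?_
    have hlim : Tendsto (fun s : ℝ => (s : ℂ) * ε) (𝓝 0) (𝓝 0) := by
      have : Continuous fun s : ℝ => (s : ℂ) * ε := by fun_prop
      simpa using this.tendsto 0
    filter_upwards [hlim.eventually hcF, (hclim.comp hlim).eventually hle] with s h1 h2
    have h3 := h2 (deriv c (s * ε))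
    simp only [Function.comp_apply] at h3
    simp only [h1.deriv, Complex.ofReal_zero, zero_mul, hdcF0, hc0, hdc0,
      FunLike.coe_smul, Pi.smul_apply, ContinuousLinearMap.coe_id', id, smul_eq_mul]
    linarith
  have hd : ∀ α β, DifferentiableAt ℝ (fun w => H w α β) z := fun α β =>
    (hH α β).differentiableAt (by simp)
  have hdG : ∀ α β, DifferentiableAt ℝ (fun w => G w α β) (F z) := fun α β =>
    (hG α β).differentiableAt (by simp)
  rw [hc0, hdc0, hddc0, hessTerm_add_eq hd hHherm hHpos, hA, neg_add_cancel,
    hermForm_zero_left, add_zero] at hsum₁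
  rw [hdcF0, hc0, hessTerm_add_eq hdG hGherm hGpos] at hsum₂
  set V := deriv (deriv fun t => F (c t)) 0 + christoffelVec G (F z) (fderiv ℂ F z W)
  have hV : 0 ≤ (hermForm (G (F z)) V V).re := by
    by_cases hV0 : V = 0
    · simp [hV0, hermForm_zero_left]
    · exact (hGpos V hV0).le
  have e₁ := congrArg Complex.re hsum₁
  have e₂ := congrArg Complex.re hsum₂
  simp only [Complex.add_re, Complex.mul_re, Complex.re_ofNat, Complex.im_ofNat, zero_mul,
    sub_zero, Complex.neg_re] at e₁ e₂
  have h1 := hJ 1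
  have h2 := hJ Complex.I
  have h3 : lam * (J₁ 1).re + lam * (J₁ Complex.I).re = lam * (4 * -(curvValue H z W).re) := by
    rw [← e₁]; ring
  linarith

/-! ### Continuity of the derivative of a holomorphic map -/

/-- On a finite-dimensional space complex differentiability on an open set implies continuity of
the derivative: by the Cauchy estimate on small discs, each directional derivative is continuous. -/
theorem continuousOn_fderiv_of_holomorphic {E F : Type*} [NormedAddCommGroup E] [NormedSpace ℂ E]
    [FiniteDimensional ℂ E] [NormedAddCommGroup F] [NormedSpace ℂ F]
    {f : E → F} {U : Set E} (hU : IsOpen U) (hf : DifferentiableOn ℂ f U) :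
    ContinuousOn (fderiv ℂ f) U := by
  rw [continuousOn_clm_apply]
  intro w z hz
  refine ContinuousAt.continuousWithinAt ?_
  -- The disc `z + t w`, `|t| ≤ r`, and its translates near it stay in `U`.
  have hline : Continuous fun p : E × ℂ => p.1 + p.2 • w := by fun_prop
  obtain ⟨r, hr, hrU⟩ : ∃ r > 0, ∀ t ∈ Metric.closedBall (0 : ℂ) r, z + t • w ∈ U := by
    have h0 : ∀ᶠ t in 𝓝 (0 : ℂ), z + t • w ∈ U := by
      have : Continuous fun t : ℂ => z + t • w := by fun_prop
      exact this.continuousAt.eventually_mem (hU.mem_nhds (by simpa using hz))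
    obtain ⟨r, hr, h⟩ := Metric.nhds_basis_closedBall.eventually_iff.1 h0
    exact ⟨r, hr, fun t ht => h ht⟩
  have hnear : ∀ᶠ y in 𝓝 z, ∀ t ∈ Metric.closedBall (0 : ℂ) r, y + t • w ∈ U :=
    (isCompact_closedBall _ _).eventually_forall_of_forall_eventually fun t ht =>
      hline.continuousAt.eventually_mem (hU.mem_nhds (hrU t ht))
  have hderiv : ∀ y t, y + t • w ∈ U →
      HasDerivAt (fun t : ℂ => f (y + t • w)) (fderiv ℂ f (y + t • w) w) t := fun y t hyt => by
    have h1 := ((hasDerivAt_id t).smul_const w).const_add y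
    rw [one_smul] at h1
    exact ((hf.differentiableAt (hU.mem_nhds hyt)).hasFDerivAt).comp_hasDerivAt t h1
  have h0mem : (0 : ℂ) ∈ Metric.closedBall (0 : ℂ) r := Metric.mem_closedBall_self hr.le
  rw [Metric.continuousAt_iff']
  intro η hη
  have hclose : ∀ᶠ y in 𝓝 z, ∀ t ∈ Metric.sphere (0 : ℂ) r,
      ‖f (y + t • w) - f (z + t • w)‖ < η / 2 * r := by
    refine (isCompact_sphere _ _).eventually_forall_of_forall_eventually fun t ht => ?_
    have hmem := hrU t (Metric.sphere_subset_closedBall ht)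
    have hcont : ContinuousAt f (z + t • w) :=
      (hf.differentiableAt (hU.mem_nhds hmem)).continuousAt
    have h1 : ContinuousAt (fun p : E × ℂ => f (p.1 + p.2 • w)) (z, t) :=
      ContinuousAt.comp (g := f) hcont hline.continuousAt
    have h2 : ContinuousAt (fun p : E × ℂ => f (z + p.2 • w)) (z, t) := by
      refine ContinuousAt.comp (g := f) (f := fun p : E × ℂ => z + p.2 • w) hcont ?_
      fun_prop
    have h3 := (h1.sub h2).norm
    have hpos : 0 < η / 2 * r := by positivity
    exact h3.eventually_lt_const (by simpa only [Pi.sub_apply, sub_self, norm_zero] using hpos)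
  filter_upwards [hnear, hclose] with y hy1 hy2
  have hd : ∀ t ∈ Metric.closedBall (0 : ℂ) r, HasDerivAt
      (fun t : ℂ => f (y + t • w) - f (z + t • w))
      (fderiv ℂ f (y + t • w) w - fderiv ℂ f (z + t • w) w) t := fun t ht =>
    (hderiv y t (hy1 t ht)).sub (hderiv z t (hrU t ht))
  have hbound := Complex.norm_deriv_le_of_forall_mem_sphere_norm_le hr
    (DifferentiableOn.diffContOnCl_ball (U := Metric.closedBall (0 : ℂ) r)
      (fun t ht => (hd t ht).differentiableAt.differentiableWithinAt) subset_rfl)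
    (fun t ht => (hy2 t ht).le)
  rw [(hd 0 h0mem).deriv, zero_smul, add_zero, add_zero, mul_div_cancel_right₀ _ hr.ne'] at hbound
  rw [dist_eq_norm]
  linarith

/-! ### Metrics and holomorphic maps in charts -/

section CoordMap

variable {m n : ℕ} {M N : Type*} [TopologicalSpace M] [TopologicalSpace N]
  {e : OpenPartialHomeomorph M (Cn m)} {e' : OpenPartialHomeomorph N (Cn n)} {f : M → N}

/-- The domain of the coordinate expression `e' ∘ f ∘ e⁻¹` of `f`. -/
def coordDomain (e : OpenPartialHomeomorph M (Cn m)) (e' : OpenPartialHomeomorph N (Cn n))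
    (f : M → N) : Set (Cn m) :=
  e.target ∩ (fun z => f (e.symm z)) ⁻¹' e'.source

/-- The coordinate expression `e' ∘ f ∘ e⁻¹` of `f`. -/
noncomputable def coordMap (e : OpenPartialHomeomorph M (Cn m))
    (e' : OpenPartialHomeomorph N (Cn n))
    (f : M → N) (z : Cn m) : Cn n :=
  e' (f (e.symm z))

theorem isOpen_coordDomain (hf : Continuous f) : IsOpen (coordDomain e e' f) :=
  ContinuousOn.isOpen_inter_preimage (hf.comp_continuousOn e.continuousOn_symm) e.open_target
    e'.open_source

theorem mem_coordDomain {x : M} (hx : x ∈ e.source) (hfx : f x ∈ e'.source) :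
    e x ∈ coordDomain e e' f :=
  ⟨e.map_source hx, by simpa [e.left_inv hx] using hfx⟩

theorem coordMap_apply {x : M} (hx : x ∈ e.source) : coordMap e e' f (e x) = e' (f x) := by
  rw [coordMap, e.left_inv hx]

end CoordMap

section Chart

variable {m : ℕ} {M : Type*} [TopologicalSpace M] [ChartedSpace (Cn m) M]

/-- The squared length of a tangent vector. The vector is taken in the model space, to which every
tangent space is definitionally equal, so that the base point can be rewritten. -/
noncomputable def HermitianMetric.normSq (h : HermitianMetric m M) (x : M) (v : Cn m) : ℝ :=
  (h.form x v v).re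

/-- The tangent vector with components `w` in the chart `e`, at the point with coordinates `z`. -/
noncomputable def chartVec (e : OpenPartialHomeomorph M (Cn m)) (z w : Cn m) : Cn m :=
  mfderiv 𝓘(ℂ, Cn m) 𝓘(ℂ, Cn m) e.symm z w

namespace HermitianMetric

theorem normSq_pos (h : HermitianMetric m M) (x : M) {v : Cn m} (hv : v ≠ 0) :
    0 < h.normSq x v :=
  h.pos_def x v hv

theorem normSq_zero (h : HermitianMetric m M) (x : M) : h.normSq x 0 = 0 :=
  (congrArg Complex.re (LinearMap.map_zero (h.form x 0))).trans Complex.zero_re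

theorem normSq_nonneg (h : HermitianMetric m M) (x : M) (v : Cn m) : 0 ≤ h.normSq x v := by
  rcases eq_or_ne v 0 with rfl | hv
  · exact (h.normSq_zero x).ge
  · exact (h.normSq_pos x hv).le

theorem conj_matrix (h : HermitianMetric m M) (e : OpenPartialHomeomorph M (Cn m)) (z : Cn m)
    (α β : Fin m) : conj (h.matrix e z α β) = h.matrix e z β α :=
  h.conj_symm _ _ _

theorem normSq_chartVec (h : HermitianMetric m M) (e : OpenPartialHomeomorph M (Cn m))
    (z w : Cn m) :
    h.normSq (e.symm z) (chartVec e z w) = (hermForm (h.matrix e z) w w).re := by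
  have hw : w = ∑ α, w α • (EuclideanSpace.single α (1 : ℂ) : Cn m) := by
    ext i
    simp [Pi.single_apply]
  have hv : (mfderiv 𝓘(ℂ, Cn m) 𝓘(ℂ, Cn m) e.symm z w : TangentSpace 𝓘(ℂ, Cn m) (e.symm z))
      = ∑ α, w α • coordVec e z α := by
    conv_lhs => rw [hw]
    erw [map_sum]
    exact Finset.sum_congr rfl fun α _ => map_smul _ _ _
  change (h.form (e.symm z) (mfderiv 𝓘(ℂ, Cn m) 𝓘(ℂ, Cn m) e.symm z w)
    (mfderiv 𝓘(ℂ, Cn m) 𝓘(ℂ, Cn m) e.symm z w)).re = _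
  rw [hv, hermForm]
  congr 1
  simp only [map_sum, LinearMap.sum_apply, map_smul, LinearMap.smul_apply, LinearMap.map_smulₛₗ,
    smul_eq_mul, Finset.mul_sum]
  rw [Finset.sum_comm]
  refine Finset.sum_congr rfl fun α _ => Finset.sum_congr rfl fun β _ => ?_
  simp only [matrix, Matrix.of_apply]
  ring

theorem contDiffAt_matrix (h : HermitianMetric m M) {e : OpenPartialHomeomorph M (Cn m)}
    (he : e ∈ atlas (Cn m) M) {z : Cn m} (hz : z ∈ e.target) (α β : Fin m) :
    ContDiffAt ℝ 2 (fun w => h.matrix e w α β) z :=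
  ((h.smooth e he α β).contDiffAt (e.open_target.mem_nhds hz)).of_le
    (WithTop.coe_le_coe.2 (le_top : (2 : ℕ∞) ≤ ⊤))

theorem holSectCurv_eq (h : HermitianMetric m M) (x : M) (v : Cn m) :
    h.holSectCurv x v = (curvValue (h.matrix (chartAt (Cn m) x)) (chartAt (Cn m) x x)
      (mfderiv 𝓘(ℂ, Cn m) 𝓘(ℂ, Cn m) (chartAt (Cn m) x) x v : Cn m)).re / h.normSq x v ^ 2 :=
  rfl

end HermitianMetric

variable [IsManifold 𝓘(ℂ, Cn m) ω M] {e : OpenPartialHomeomorph M (Cn m)}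

theorem chart_mdifferentiable (he : e ∈ atlas (Cn m) M) :
    e.MDifferentiable 𝓘(ℂ, Cn m) 𝓘(ℂ, Cn m) := by
  have : IsManifold 𝓘(ℂ, Cn m) 1 M := IsManifold.of_le (n := ω) le_top
  exact mdifferentiable_of_mem_atlas he

theorem chartVec_mfderiv (he : e ∈ atlas (Cn m) M) {x : M} (hx : x ∈ e.source) (v : Cn m) :
    chartVec e (e x) (mfderiv 𝓘(ℂ, Cn m) 𝓘(ℂ, Cn m) e x v) = v :=
  congrArg (fun L => L v) ((chart_mdifferentiable he).symm_comp_deriv hx)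

theorem mfderiv_chartVec (he : e ∈ atlas (Cn m) M) {z : Cn m} (hz : z ∈ e.target) (w : Cn m) :
    (mfderiv 𝓘(ℂ, Cn m) 𝓘(ℂ, Cn m) e (e.symm z) (chartVec e z w) : Cn m) = w :=
  congrArg (fun L => L w) ((chart_mdifferentiable he).comp_symm_deriv hz)

theorem chartVec_ne_zero (he : e ∈ atlas (Cn m) M) {z : Cn m} (hz : z ∈ e.target) {w : Cn m}
    (hw : w ≠ 0) : chartVec e z w ≠ 0 := by
  intro h0
  have h1 := mfderiv_chartVec he hz w
  rw [h0] at h1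
  exact hw (h1.symm.trans (map_zero (mfderiv 𝓘(ℂ, Cn m) 𝓘(ℂ, Cn m) e (e.symm z))))

theorem hermForm_matrix_pos (h : HermitianMetric m M) (he : e ∈ atlas (Cn m) M) {z : Cn m}
    (hz : z ∈ e.target) {w : Cn m} (hw : w ≠ 0) : 0 < (hermForm (h.matrix e z) w w).re := by
  rw [← h.normSq_chartVec]
  exact h.normSq_pos _ (chartVec_ne_zero he hz hw)

end Chart

section HolomorphicMap

variable {m n : ℕ} {M : Type*} [TopologicalSpace M] [ChartedSpace (Cn m) M]
  {N : Type*} [TopologicalSpace N] [ChartedSpace (Cn n) N]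
  {e : OpenPartialHomeomorph M (Cn m)} {e' : OpenPartialHomeomorph N (Cn n)} {f : M → N}

/-- The differential of `f`, as a map between the model spaces, to which the tangent spaces are
definitionally equal. -/
noncomputable def diffMap (f : M → N) (x : M) (v : Cn m) : Cn n :=
  mfderiv 𝓘(ℂ, Cn m) 𝓘(ℂ, Cn n) f x v

theorem mdifferentiableAt_comp_symm [IsManifold 𝓘(ℂ, Cn m) ω M]
    (hf : MDifferentiable 𝓘(ℂ, Cn m) 𝓘(ℂ, Cn n) f)
    (he : e ∈ atlas (Cn m) M) {z : Cn m} (hz : z ∈ e.target) :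
    MDifferentiableAt 𝓘(ℂ, Cn m) 𝓘(ℂ, Cn n) (fun z => f (e.symm z)) z :=
  (hf (e.symm z)).comp z ((chart_mdifferentiable he).mdifferentiableAt_symm hz)

variable [IsManifold 𝓘(ℂ, Cn m) ω M] [IsManifold 𝓘(ℂ, Cn n) ω N]

theorem differentiableAt_coordMap (hf : MDifferentiable 𝓘(ℂ, Cn m) 𝓘(ℂ, Cn n) f)
    (he : e ∈ atlas (Cn m) M) (he' : e' ∈ atlas (Cn n) N)
    {z : Cn m} (hz : z ∈ coordDomain e e' f) :
    DifferentiableAt ℂ (coordMap e e' f) z := by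
  rw [← mdifferentiableAt_iff_differentiableAt]
  exact ((chart_mdifferentiable he').mdifferentiableAt hz.2).comp z
    (mdifferentiableAt_comp_symm hf he hz.1)

theorem diffMap_chartVec (hf : MDifferentiable 𝓘(ℂ, Cn m) 𝓘(ℂ, Cn n) f)
    (he : e ∈ atlas (Cn m) M) (he' : e' ∈ atlas (Cn n) N)
    {z : Cn m} (hz : z ∈ coordDomain e e' f) (w : Cn m) :
    diffMap f (e.symm z) (chartVec e z w)
      = chartVec e' (coordMap e e' f z) (fderiv ℂ (coordMap e e' f) z w) := by
  have hF := differentiableAt_coordMap hf he he' hz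
  have hU : coordDomain e e' f ∈ 𝓝 z := (isOpen_coordDomain hf.continuous).mem_nhds hz
  have heq : (fun z => f (e.symm z)) =ᶠ[𝓝 z] fun z => e'.symm (coordMap e e' f z) := by
    filter_upwards [hU] with y hy using (e'.left_inv hy.2).symm
  have h1 := mfderiv_comp z (hf (e.symm z))
    ((chart_mdifferentiable he).mdifferentiableAt_symm hz.1)
  have h2 := mfderiv_comp z
    ((chart_mdifferentiable he').mdifferentiableAt_symm (e'.map_source hz.2))
    hF.mdifferentiableAt
  have h3 := heq.mfderiv_eq (I := 𝓘(ℂ, Cn m)) (I' := 𝓘(ℂ, Cn n))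
  have h1' := congrArg (fun L => L w) h1
  have h2' := congrArg (fun L => L w) h2
  have h3' := congrArg (fun L => L w) h3
  rw [mfderiv_eq_fderiv] at h2'
  exact (h1'.symm.trans h3').trans h2'

theorem normSq_diffMap_chartVec (hf : MDifferentiable 𝓘(ℂ, Cn m) 𝓘(ℂ, Cn n) f)
    (he : e ∈ atlas (Cn m) M) (he' : e' ∈ atlas (Cn n) N)
    (g : HermitianMetric n N) {z : Cn m}
    (hz : z ∈ coordDomain e e' f) (w : Cn m) :
    g.normSq (f (e.symm z)) (diffMap f (e.symm z) (chartVec e z w))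
      = (hermForm (g.matrix e' (coordMap e e' f z)) (fderiv ℂ (coordMap e e' f) z w)
        (fderiv ℂ (coordMap e e' f) z w)).re := by
  have h1 : f (e.symm z) = e'.symm (coordMap e e' f z) := (e'.left_inv hz.2).symm
  rw [diffMap_chartVec hf he he' hz, h1, g.normSq_chartVec]

end HolomorphicMap

/-! ### Maxima of the energy density -/

variable {m n : ℕ} {M : Type*} [TopologicalSpace M] [ChartedSpace (Cn m) M]
  {N : Type*} [TopologicalSpace N] [ChartedSpace (Cn n) N] {f : M → N}

theorem continuousOn_hermForm_matrix (h : HermitianMetric m M)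
    {e : OpenPartialHomeomorph M (Cn m)} (he : e ∈ atlas (Cn m) M) :
    ContinuousOn (fun p : Cn m × Cn m => (hermForm (h.matrix e p.1) p.2 p.2).re)
      (e.target ×ˢ Set.univ) := by
  unfold hermForm
  refine Complex.continuous_re.comp_continuousOn ?_
  refine continuousOn_finsetSum _ fun α _ => continuousOn_finsetSum _ fun β _ => ?_
  have h1 : ContinuousOn (fun p : Cn m × Cn m => h.matrix e p.1 α β) (e.target ×ˢ Set.univ) :=
    (h.smooth e he α β).continuousOn.comp continuousOn_fst fun p hp => hp.1
  have h2 : Continuous fun p : Cn m × Cn m => p.2 α := by fun_prop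
  have h3 : Continuous fun p : Cn m × Cn m => conj (p.2 β) :=
    Complex.continuous_conj.comp (by fun_prop)
  exact (h1.mul h2.continuousOn).mul h3.continuousOn

variable [IsManifold 𝓘(ℂ, Cn m) ω M] [IsManifold 𝓘(ℂ, Cn n) ω N]

/-- The energy density `|df(v)|² / |v|²` is, over a neighbourhood of every point, bounded by one of
its values. -/
theorem exists_local_bound [Nontrivial (Cn m)] (h : HermitianMetric m M) (g : HermitianMetric n N)
    (hf : MDifferentiable 𝓘(ℂ, Cn m) 𝓘(ℂ, Cn n) f) (x₀ : M) :
    ∃ t ∈ 𝓝 x₀, ∃ (x₁ : M) (v₁ : Cn m), v₁ ≠ 0 ∧ ∀ x ∈ t, ∀ v : Cn m,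
      g.normSq (f x) (diffMap f x v)
        ≤ g.normSq (f x₁) (diffMap f x₁ v₁) / h.normSq x₁ v₁ * h.normSq x v := by
  set e := chartAt (Cn m) x₀
  set e' := chartAt (Cn n) (f x₀)
  have he : e ∈ atlas (Cn m) M := chart_mem_atlas _ _
  have he' : e' ∈ atlas (Cn n) N := chart_mem_atlas _ _
  have hx₀ : x₀ ∈ e.source := mem_chart_source _ _
  set F := coordMap e e' f
  set U := coordDomain e e' f
  have hU : IsOpen U := isOpen_coordDomain hf.continuous
  have hz₀ : e x₀ ∈ U := mem_coordDomain hx₀ (mem_chart_source _ _)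
  obtain ⟨r, hr, hrU⟩ := Metric.nhds_basis_closedBall.mem_iff.1 (hU.mem_nhds hz₀)
  have hFd : DifferentiableOn ℂ F U := fun z hz =>
    (differentiableAt_coordMap hf he he' hz).differentiableWithinAt
  set S : Set (Cn m × Cn m) := Metric.closedBall (e x₀) r ×ˢ Metric.sphere 0 1
  have hScomp : IsCompact S := (isCompact_closedBall _ _).prod (isCompact_sphere _ _)
  have hSne : S.Nonempty := by
    obtain ⟨w, hw⟩ := (NormedSpace.sphere_nonempty (E := Cn m) (x := 0) (r := 1)).2 zero_le_one
    exact ⟨(e x₀, w), Metric.mem_closedBall_self hr.le, hw⟩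
  have hSU : ∀ p ∈ S, p.1 ∈ U := fun p hp => hrU hp.1
  have hSw : ∀ p ∈ S, p.2 ≠ 0 := fun p hp h0 => by
    have := hp.2
    simp [h0] at this
  set a : Cn m × Cn m → ℝ := fun p => (hermForm (h.matrix e p.1) p.2 p.2).re
  set b : Cn m × Cn m → ℝ := fun p =>
    (hermForm (g.matrix e' (F p.1)) (fderiv ℂ F p.1 p.2) (fderiv ℂ F p.1 p.2)).re
  have ha : ContinuousOn a S :=
    (continuousOn_hermForm_matrix h he).mono fun p hp => ⟨(hSU p hp).1, trivial⟩
  have hb : ContinuousOn b S := by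
    have h1 : ContinuousOn (fun p : Cn m × Cn m => F p.1) S :=
      ContinuousOn.comp (g := F) hFd.continuousOn continuousOn_fst hSU
    have h0 : ContinuousOn (fderiv ℂ F) U := continuousOn_fderiv_of_holomorphic hU hFd
    have h2 : ContinuousOn (fun p : Cn m × Cn m => fderiv ℂ F p.1) S :=
      h0.comp continuousOn_fst hSU
    have h3 : ContinuousOn (fun p : Cn m × Cn m => fderiv ℂ F p.1 p.2) S :=
      h2.clm_apply continuousOn_snd
    have hmaps : Set.MapsTo (fun p : Cn m × Cn m => (F p.1, fderiv ℂ F p.1 p.2)) S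
        (e'.target ×ˢ Set.univ) := fun p hp =>
      Set.mk_mem_prod (e'.map_source (hSU p hp).2) (Set.mem_univ _)
    have hcomp := (continuousOn_hermForm_matrix g he').comp (h1.prodMk h3) hmaps
    exact hcomp
  have hapos : ∀ p ∈ S, 0 < a p := fun p hp =>
    hermForm_matrix_pos h he (hSU p hp).1 (hSw p hp)
  obtain ⟨p₁, hp₁, hmax⟩ := hScomp.exists_isMaxOn hSne (hb.div ha fun p hp => (hapos p hp).ne')
  refine ⟨e.source ∩ e ⁻¹' Metric.closedBall (e x₀) r,
    inter_mem (e.open_source.mem_nhds hx₀)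
      ((e.continuousAt hx₀).preimage_mem_nhds (Metric.closedBall_mem_nhds _ hr)),
    e.symm p₁.1, chartVec e p₁.1 p₁.2, chartVec_ne_zero he (hSU p₁ hp₁).1 (hSw p₁ hp₁), ?_⟩
  rintro x ⟨hx, hxr⟩ v
  rw [normSq_diffMap_chartVec hf he he' g (hSU p₁ hp₁), h.normSq_chartVec]
  obtain ⟨w, hw⟩ : ∃ w : Cn m, v = chartVec e (e x) w := ⟨_, (chartVec_mfderiv he hx v).symm⟩
  have h1 := normSq_diffMap_chartVec hf he he' g (hrU hxr) w
  have h2 := h.normSq_chartVec e (e x) w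
  rw [e.left_inv hx, ← hw] at h1 h2
  rw [h1, h2]
  rcases eq_or_ne w 0 with rfl | hw0
  · simp [hermForm_zero_left]
  -- Both sides are quadratic in `w`, so it may be normalized.
  have hnorm : 0 < ‖w‖ := norm_pos_iff.2 hw0
  set u : Cn m := ‖w‖⁻¹ • w
  have hwu : w = ‖w‖ • u := by rw [smul_smul, mul_inv_cancel₀ hnorm.ne', one_smul]
  have hu : (e x, u) ∈ S := ⟨hxr, by
    rw [mem_sphere_zero_iff_norm, norm_smul, norm_inv, norm_norm, inv_mul_cancel₀ hnorm.ne']⟩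
  have hquot : b (e x, u) ≤ b p₁ / a p₁ * a (e x, u) :=
    (div_le_iff₀ (hapos _ hu)).1 (hmax hu)
  have hlin : fderiv ℂ F (e x) w = ‖w‖ • fderiv ℂ F (e x) u := by
    conv_lhs => rw [hwu]
    exact map_smul ((fderiv ℂ F (e x)).restrictScalars ℝ) _ _
  rw [hlin, hermForm_smul_smul]
  conv_rhs => rw [hwu, hermForm_smul_smul]
  calc _ ≤ ‖w‖ ^ 2 * (b p₁ / a p₁ * a (e x, u)) := by gcongr
    _ = _ := by ring

/-- On a compact manifold the energy density attains its maximum. -/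
theorem exists_max_energy [CompactSpace M] [Nonempty M] [Nontrivial (Cn m)]
    (h : HermitianMetric m M) (g : HermitianMetric n N)
    (hf : MDifferentiable 𝓘(ℂ, Cn m) 𝓘(ℂ, Cn n) f) :
    ∃ (x₁ : M) (v₁ : Cn m), v₁ ≠ 0 ∧ ∀ (x : M) (v : Cn m), g.normSq (f x) (diffMap f x v)
        ≤ g.normSq (f x₁) (diffMap f x₁ v₁) / h.normSq x₁ v₁ * h.normSq x v := by
  suffices H : ∃ (x₁ : M) (v₁ : Cn m), v₁ ≠ 0 ∧ ∀ x ∈ (Set.univ : Set M), ∀ v : Cn m,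
      g.normSq (f x) (diffMap f x v)
        ≤ g.normSq (f x₁) (diffMap f x₁ v₁) / h.normSq x₁ v₁ * h.normSq x v by
    obtain ⟨x₁, v₁, hv₁, hle⟩ := H
    exact ⟨x₁, v₁, hv₁, fun x => hle x trivial⟩
  refine isCompact_univ.induction_on ?_ ?_ ?_ ?_
  · obtain ⟨v, hv⟩ := exists_ne (0 : Cn m)
    exact ⟨Classical.arbitrary M, v, hv, fun x hx => hx.elim⟩
  · rintro s t hst ⟨x₁, v₁, hv₁, hle⟩
    exact ⟨x₁, v₁, hv₁, fun x hx => hle x (hst hx)⟩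
  · rintro s t ⟨x₁, v₁, hv₁, hle₁⟩ ⟨x₂, v₂, hv₂, hle₂⟩
    rcases le_total (g.normSq (f x₁) (diffMap f x₁ v₁) / h.normSq x₁ v₁)
      (g.normSq (f x₂) (diffMap f x₂ v₂) / h.normSq x₂ v₂) with hc | hc
    · refine ⟨x₂, v₂, hv₂, ?_⟩
      rintro x (hx | hx) v
      · exact (hle₁ x hx v).trans (mul_le_mul_of_nonneg_right hc (h.normSq_nonneg x v))
      · exact hle₂ x hx v
    · refine ⟨x₁, v₁, hv₁, ?_⟩
      rintro x (hx | hx) v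
      · exact hle₁ x hx v
      · exact (hle₂ x hx v).trans (mul_le_mul_of_nonneg_right hc (h.normSq_nonneg x v))
  · intro x₀ _
    obtain ⟨t, ht, H⟩ := exists_local_bound h g hf x₀
    exact ⟨t, mem_nhdsWithin_of_mem_nhds ht, H⟩

/-- At a maximum of the energy density, the holomorphic sectional curvatures of `M` and `N` in the
maximizing direction compare, up to positive factors. -/
theorem mul_holSectCurv_le (h : HermitianMetric m M) (g : HermitianMetric n N)
    (hf : MDifferentiable 𝓘(ℂ, Cn m) 𝓘(ℂ, Cn n) f) {x₁ : M} {v₁ : Cn m} (hv₁ : v₁ ≠ 0) {lam : ℝ}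
    (hle : ∀ (x : M) (v : Cn m), g.normSq (f x) (diffMap f x v) ≤ lam * h.normSq x v)
    (heq : g.normSq (f x₁) (diffMap f x₁ v₁) = lam * h.normSq x₁ v₁)
    (hne : (diffMap f x₁ v₁ : Cn n) ≠ 0) :
    lam * (h.holSectCurv x₁ v₁ * h.normSq x₁ v₁ ^ 2)
      ≤ g.holSectCurv (f x₁) (diffMap f x₁ v₁) * g.normSq (f x₁) (diffMap f x₁ v₁) ^ 2 := by
  have hpos₁ := h.normSq_pos x₁ hv₁
  have hpos₂ := g.normSq_pos (f x₁) hne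
  rw [h.holSectCurv_eq, g.holSectCurv_eq, div_mul_cancel₀ _ (pow_pos hpos₁ 2).ne',
    div_mul_cancel₀ _ (pow_pos hpos₂ 2).ne']
  set e := chartAt (Cn m) x₁
  set e' := chartAt (Cn n) (f x₁)
  have he : e ∈ atlas (Cn m) M := chart_mem_atlas _ _
  have he' : e' ∈ atlas (Cn n) N := chart_mem_atlas _ _
  have hx₁ : x₁ ∈ e.source := mem_chart_source _ _
  have hfx₁ : f x₁ ∈ e'.source := mem_chart_source _ _
  set F := coordMap e e' f with hF
  have hU : IsOpen (coordDomain e e' f) := isOpen_coordDomain hf.continuous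
  have hz₁ : e x₁ ∈ coordDomain e e' f := mem_coordDomain hx₁ hfx₁
  set W : Cn m := mfderiv 𝓘(ℂ, Cn m) 𝓘(ℂ, Cn m) e x₁ v₁
  have hW : chartVec e (e x₁) W = v₁ := chartVec_mfderiv he hx₁ v₁
  have hFz : F (e x₁) = e' (f x₁) := coordMap_apply hx₁
  have hdF : (mfderiv 𝓘(ℂ, Cn n) 𝓘(ℂ, Cn n) e' (f x₁) (diffMap f x₁ v₁) : Cn n)
      = fderiv ℂ F (e x₁) W := by
    have h1 := diffMap_chartVec hf he he' hz₁ W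
    rw [e.left_inv hx₁, hW] at h1
    have h2 := mfderiv_chartVec he' (z := F (e x₁)) (e'.map_source hz₁.2) (fderiv ℂ F (e x₁) W)
    rw [← h1, hFz, e'.left_inv hfx₁] at h2
    exact h2
  rw [hdF, ← hFz]
  have htarget : F (e x₁) ∈ e'.target := e'.map_source hz₁.2
  refine mul_curvValue_le (h.contDiffAt_matrix he hz₁.1)
    (Eventually.of_forall fun z => h.conj_matrix e z) (fun u => hermForm_matrix_pos h he hz₁.1)
    (g.contDiffAt_matrix he' htarget) (Eventually.of_forall fun z => g.conj_matrix e' z)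
    (fun u => hermForm_matrix_pos g he' htarget) ?_ ?_ ?_
  · filter_upwards [hU.mem_nhds hz₁] with z hz using differentiableAt_coordMap hf he he' hz
  · filter_upwards [hU.mem_nhds hz₁] with z hz u
    rw [← normSq_diffMap_chartVec hf he he' g hz, ← h.normSq_chartVec]
    exact hle _ _
  · rw [← normSq_diffMap_chartVec hf he he' g hz₁, ← h.normSq_chartVec, hW, e.left_inv hx₁]
    exact heq

/-- A holomorphic map with vanishing differential is locally constant. -/
theorem isLocallyConstant_of_diffMap_eq_zero (hf : MDifferentiable 𝓘(ℂ, Cn m) 𝓘(ℂ, Cn n) f)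
    (h0 : ∀ (x : M) (v : Cn m), (diffMap f x v : Cn n) = 0) : IsLocallyConstant f := by
  rw [IsLocallyConstant.iff_eventually_eq]
  intro x
  set e := chartAt (Cn m) x
  have he : e ∈ atlas (Cn m) M := chart_mem_atlas _ _
  have hx : x ∈ e.source := mem_chart_source _ _
  set e' := chartAt (Cn n) (f x)
  have he' : e' ∈ atlas (Cn n) N := chart_mem_atlas _ _
  have hfx : f x ∈ e'.source := mem_chart_source _ _
  have hU : IsOpen (coordDomain e e' f) := isOpen_coordDomain hf.continuous
  have hdF : ∀ z ∈ coordDomain e e' f, fderiv ℂ (coordMap e e' f) z = 0 := fun z hz => by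
    ext1 w
    by_contra hne
    have h1 := diffMap_chartVec hf he he' hz w
    rw [h0] at h1
    exact chartVec_ne_zero he' (e'.map_source hz.2) hne h1.symm
  obtain ⟨r, hr, hrU⟩ := Metric.isOpen_iff.1 hU (e x) (mem_coordDomain hx hfx)
  filter_upwards [e.open_source.mem_nhds hx,
    (e.continuousAt hx).preimage_mem_nhds (Metric.ball_mem_nhds _ hr)] with y hy hyr
  have hconst : coordMap e e' f (e y) = coordMap e e' f (e x) :=
    Metric.isOpen_ball.is_const_of_fderiv_eq_zero (𝕜 := ℂ)
      (convex_ball (e x) r).isPreconnected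
      (fun z hz => (differentiableAt_coordMap hf he he' (hrU hz)).differentiableWithinAt)
      (fun z hz => hdF z (hrU hz)) hyr (Metric.mem_ball_self hr)
  rw [coordMap_apply hy, coordMap_apply hx] at hconst
  have hfy : f y ∈ e'.source := by
    have := (hrU hyr).2
    rwa [Set.mem_preimage, e.left_inv hy] at this
  exact e'.injOn hfy hfx hconst

theorem isLocallyConstant_of_curvature [CompactSpace M] [Nonempty M] (h : HermitianMetric m M)
    (g : HermitianMetric n N) (hf : MDifferentiable 𝓘(ℂ, Cn m) 𝓘(ℂ, Cn n) f)
    (hcurv : (h.PosHSC ∧ g.NonposHSC) ∨ (h.NonnegHSC ∧ g.NegHSC)) : IsLocallyConstant f := by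
  refine isLocallyConstant_of_diffMap_eq_zero hf fun x v => ?_
  rcases subsingleton_or_nontrivial (Cn m) with hsub | hnt
  · rw [Subsingleton.elim v 0]
    exact map_zero (mfderiv 𝓘(ℂ, Cn m) 𝓘(ℂ, Cn n) f x)
  by_contra hxv
  obtain ⟨x₁, v₁, hv₁, hle⟩ := exists_max_energy h g hf
  have hpos₁ := h.normSq_pos x₁ hv₁
  set lam := g.normSq (f x₁) (diffMap f x₁ v₁) / h.normSq x₁ v₁ with hlam
  have heq : g.normSq (f x₁) (diffMap f x₁ v₁) = lam * h.normSq x₁ v₁ :=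
    (div_mul_cancel₀ _ hpos₁.ne').symm
  have hlampos : 0 < lam :=
    pos_of_mul_pos_left ((g.normSq_pos (f x) hxv).trans_le (hle x v)) (h.normSq_nonneg x v)
  have hne : (diffMap f x₁ v₁ : Cn n) ≠ 0 := fun h0 => by
    rw [hlam, h0, g.normSq_zero, zero_div] at hlampos
    exact hlampos.false
  have hpos₂ := g.normSq_pos (f x₁) hne
  have key := mul_holSectCurv_le h g hf hv₁ hle heq hne
  rcases hcurv with ⟨hM, hN⟩ | ⟨hM, hN⟩
  · have h1 := mul_pos hlampos (mul_pos (hM x₁ v₁ hv₁) (pow_pos hpos₁ 2))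
    have h2 := mul_nonpos_of_nonpos_of_nonneg (hN (f x₁) _ hne) (pow_pos hpos₂ 2).le
    linarith
  · have h1 := mul_nonneg hlampos.le (mul_nonneg (hM x₁ v₁ hv₁) (pow_pos hpos₁ 2).le)
    have h2 := mul_neg_of_neg_of_pos (hN (f x₁) _ hne) (pow_pos hpos₂ 2)
    linarith

end HermitianGeometry

theorem theorem1p2 {m n : ℕ}
    {M : Type*} [TopologicalSpace M] [T2Space M] [CompactSpace M] [ConnectedSpace M]
    [ChartedSpace (HermitianGeometry.Cn m) M] [IsManifold 𝓘(ℂ, HermitianGeometry.Cn m) ω M]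
    {N : Type*} [TopologicalSpace N] [T2Space N]
    [ChartedSpace (HermitianGeometry.Cn n) N] [IsManifold 𝓘(ℂ, HermitianGeometry.Cn n) ω N]
    (h : HermitianGeometry.HermitianMetric m M) (g : HermitianGeometry.HermitianMetric n N)
    (f : M → N)
    (hf : MDifferentiable 𝓘(ℂ, HermitianGeometry.Cn m) 𝓘(ℂ, HermitianGeometry.Cn n) f)
    (hcurv : (h.PosHSC ∧ g.NonposHSC) ∨ (h.NonnegHSC ∧ g.NegHSC)) :
    ∃ c : N, ∀ x : M, f x = c :=
  have hconst := HermitianGeometry.isLocallyConstant_of_curvature h g hf hcurv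
  ⟨f (Classical.arbitrary M), fun x => hconst.apply_eq_of_preconnectedSpace x _⟩
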